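/- Let $G$ be a compact Lie group, $\Sigma$ a Hausdorff real-analytic manifold, and $\pi\colon P\to\Sigma$ a real-analytic principal fibre bundle with structure group $G$. Let $S$ be a Lie group acting analytically on $P$ by bundle automorphisms, and hence also on $\Sigma$. Let $F\le S$ be a subgroup and $B\subset\Sigma$ a subset that meets every $S$-orbit in exactly one point and all of whose points have isotropy group $F$. Let $\lambda\colon F\to G$ be a homomorphism such that $P$ is classified by the conjugacy class $[\lambda]$ together with the reduced bundle $Q=\{p\in P|_B : f\cdot p=p\cdot\lambda(f)\ \text{for all } f\in F\}$; that is, $\pi(Q)=B$. *Generalized connections.* An edge is an embedded oriented curve $e\colon[0,1]\to\Sigma$ that extends analytically and immersively across its end points. A graph $\gamma$ in $\Sigma$ consists of finitely many vertices and finitely many edges between vertices, which meet each other and the vertices only in end points. We write $\gamma\le\gamma'$ if all vertices of $\gamma$ are vertices of $\gamma'$ and all edges of $\gamma$ are, up to reparametrization, compositions of edges of $\gamma'$ and their inverses. Let $\mathcal A_\gamma$ be the space of families assigning to each edge $e$ of $\gamma$ a $G$-equivariant map $A(e)\colon P_{e(0)}\to P_{e(1)}$ (an element of $G$, once a point is chosen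 in each fibre), with $A(e^{-1})=A(e)^{-1}$. Composition of transporters defines projections $\mathcal A_{\gamma'}\to\mathcal A_\gamma$ for $\gamma\le\gamma'$, and $\overline{\mathcal A}_\Sigma=\varprojlim_\gamma\mathcal A_\gamma$ carries the projective limit (Tychonov) topology. The extended gauge group $\overline{\mathcal G}_\Sigma$ is the projective limit of the groups $\mathcal G_\gamma$ of families $(g(v))_v$ of $G$-equivariant automorphisms of the fibres over the vertices $v$ of $\gamma$. It acts on $\overline{\mathcal A}_\Sigma$ by $(gA)(e)=g(e(1))\circ A(e)\circ g(e(0))^{-1}$, and $\overline{\mathcal A}_\Sigma/\overline{\mathcal G}_\Sigma$ carries the quotient topology. A generalized connection $A\in\overline{\mathcal A}_\Sigma$ is called $[\lambda]$-invariant if it is invariant under the given action of $S$ on $P$ (which is of class $[\lambda]$), i.e. $A(s\cdot e)=s\circ A(e)\circ s^{-1}$ for all $s\in S$ and all edges $e$. The set of generalized gauge-invariant, $[\lambda]$-invariant connections is the set of all classes in $\overline{\mathcal A}_\Sigma/\overline{\mathcal G}_\Sigma$ that contain a $[\lambda]$-invariant generalized connection. Then the set of generalized gauge-invariant, $[\lambda]$-invariant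 connections on $P$ is closed in $\overline{\mathcal A}_\Sigma/\overline{\mathcal G}_\Sigma$. -/

import Mathlib

open scoped Manifold ContDiff Topology RightActions

noncomputable section

/-! ### Principal bundles and symmetric principal bundles

The structure group `G` acts on the total space `P` from the right; `p <• g` is `p · g`. -/

section Bundle

/-- `π : P → M` is a real-analytic principal fibre bundle with structure group `G` acting from the
right on `P`: around every point of `M` there is a `G`-equivariant analytic local trivialization
`π ⁻¹ U ≅ U × G`. -/
structure IsPrincipalBundle (EG EM EP : Type*) (G : Type*) {M P : Type*}
    [NormedAddCommGroup EG] [NormedSpace ℝ EG] [NormedAddCommGroup EM] [NormedSpace ℝ EM]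
    [NormedAddCommGroup EP] [NormedSpace ℝ EP]
    [TopologicalSpace G] [Group G] [ChartedSpace EG G]
    [TopologicalSpace M] [ChartedSpace EM M] [TopologicalSpace P] [ChartedSpace EP P]
    [MulAction Gᵐᵒᵖ P] (π : P → M) : Prop where
  locally_trivial : ∀ x : M, ∃ U : Set M, IsOpen U ∧ x ∈ U ∧
    ∃ Φ : OpenPartialHomeomorph P (M × G),
      Φ.source = π ⁻¹' U ∧ Φ.target = U ×ˢ Set.univ ∧
      (∀ p, π p ∈ U → (Φ p).1 = π p) ∧
      (∀ p, π p ∈ U → ∀ g : G, π (p <• g) = π p ∧ (Φ (p <• g)).2 = (Φ p).2 * g) ∧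
      ContMDiffOn 𝓘(ℝ, EP) (𝓘(ℝ, EM).prod 𝓘(ℝ, EG)) ω Φ Φ.source ∧
      ContMDiffOn (𝓘(ℝ, EM).prod 𝓘(ℝ, EG)) 𝓘(ℝ, EP) ω Φ.symm Φ.target

/-- The Lie group `S` acts analytically by automorphisms of the principal bundle `π : P → M`
(commuting with the right action of `G`), covering its action on `M`. -/
structure IsSymmetryAction (ES EP : Type*) (S G : Type*) {M P : Type*}
    [NormedAddCommGroup ES] [NormedSpace ℝ ES] [NormedAddCommGroup EP] [NormedSpace ℝ EP]
    [Group G] [TopologicalSpace S] [Group S] [ChartedSpace ES S]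
    [TopologicalSpace P] [ChartedSpace EP P]
    [MulAction Gᵐᵒᵖ P] [MulAction S P] [MulAction S M] (π : P → M) : Prop where
  commutes : ∀ (s : S) (p : P) (g : G), s • (p <• g) = (s • p) <• g
  covers : ∀ (s : S) (p : P), π (s • p) = s • π p
  analytic : ContMDiff (𝓘(ℝ, ES).prod 𝓘(ℝ, EP)) 𝓘(ℝ, EP) ω (fun z : S × P => z.1 • z.2)

/-- The reduced bundle `Q` over `B` of a homomorphism `lam : F → G`: the points `p` over `B` such
that `f · p = p · lam(f)` for all `f ∈ F`. -/
def reducedBundle {S G M P : Type*} [Group G] [Group S] [MulAction Gᵐᵒᵖ P] [MulAction S P]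
    (π : P → M) (F : Subgroup S) (B : Set M) (lam : F →* G) : Set P :=
  {p | π p ∈ B ∧ ∀ f : F, (f : S) • p = p <• lam f}

/-- The symmetric bundle `π : P → M` is classified by the conjugacy class of `lam : F → G` and the
reduced bundle over `B`: all points of `B` have isotropy group `F`, every orbit of `S` in `M` meets
`B` in exactly one point, and over every point of `B` the homomorphism `f · p = p · lam_p(f)` is
`lam` for some `p`, that is, conjugate to `lam` for every `p` in the fibre. -/
structure IsClassifiedBy {S G M P : Type*} [Group G] [Group S] [MulAction Gᵐᵒᵖ P]
    [MulAction S P] [MulAction S M]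
    (π : P → M) (F : Subgroup S) (B : Set M) (lam : F →* G) : Prop where
  isotropy : ∀ x ∈ B, MulAction.stabilizer S x = F
  cross_section : ∀ x : M, ∃! b : M, b ∈ B ∧ b ∈ MulAction.orbit S x
  image_reduced : π '' reducedBundle π F B lam = B

end Bundle

/-! ### Piecewise analytic graphs -/

section Graphs

/-- A (parametrized, oriented) analytic edge in `M`: an embedded curve `[0,1] → M` that extends
analytically and immersively across the end points. -/
structure AnalyticEdge (E M : Type*) [NormedAddCommGroup E] [NormedSpace ℝ E]
    [TopologicalSpace M] [ChartedSpace E M] where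
  curve : unitInterval → M
  injective : Function.Injective curve
  analytic : ∃ f : ℝ → M, (∀ t : unitInterval, f t = curve t) ∧
    ∀ t ∈ Set.Icc (0 : ℝ) 1, ContMDiffAt 𝓘(ℝ, ℝ) 𝓘(ℝ, E) ω f t ∧
      Function.Injective (mfderiv 𝓘(ℝ, ℝ) 𝓘(ℝ, E) f t)

variable {E M : Type*} [NormedAddCommGroup E] [NormedSpace ℝ E]
  [TopologicalSpace M] [ChartedSpace E M]

/-- The initial point of an edge. -/
def AnalyticEdge.source (e : AnalyticEdge E M) : M := e.curve 0

/-- The final point of an edge. -/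
def AnalyticEdge.target (e : AnalyticEdge E M) : M := e.curve 1

/-- The curve run through forwards (`true`) or backwards (`false`). -/
def AnalyticEdge.run (e : AnalyticEdge E M) : Bool → unitInterval → M
  | true, t => e.curve t
  | false, t => e.curve (unitInterval.symm t)

variable (E M) in
/-- A piecewise analytic graph in `M`: finitely many vertices and finitely many analytic edges
between vertices, which meet each other and the vertices only in their end points. -/
structure AnalyticGraph where
  verts : Set M
  edges : Set (AnalyticEdge E M)
  finite_verts : verts.Finite
  finite_edges : edges.Finite
  source_mem : ∀ e ∈ edges, e.source ∈ verts
  target_mem : ∀ e ∈ edges, e.target ∈ verts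
  interior_verts : ∀ e ∈ edges, ∀ t : unitInterval, 0 < t → t < 1 → e.curve t ∉ verts
  interior_edges : ∀ e ∈ edges, ∀ e' ∈ edges, e ≠ e' →
    ∀ t t' : unitInterval, 0 < t → t < 1 → e.curve t ≠ e'.curve t'

/-- The edge `e` is, up to reparametrization, the composition of the edges `w 0, …, w (n-1)` of
`γ`, each run through forwards or backwards. -/
def AnalyticGraph.IsDecomposition (γ : AnalyticGraph E M) (e : AnalyticEdge E M) (n : ℕ)
    (w : Fin n → γ.edges × Bool) : Prop :=
  ∃ t : Fin (n + 1) → unitInterval, StrictMono t ∧ t 0 = 0 ∧ t (Fin.last n) = 1 ∧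
    ∀ i : Fin n, ∃ τ : unitInterval → unitInterval, Continuous τ ∧ StrictMono τ ∧
      τ 0 = t i.castSucc ∧ τ 1 = t i.succ ∧
      ∀ u, e.curve (τ u) = (w i).1.1.run (w i).2 u

/-- `γ ≤ γ'`: all vertices of `γ` are vertices of `γ'`, and all edges of `γ` are compositions of
edges of `γ'` and their inverses. -/
def AnalyticGraph.Subgraph (γ γ' : AnalyticGraph E M) : Prop :=
  γ.verts ⊆ γ'.verts ∧ ∀ e ∈ γ.edges, ∃ n w, γ'.IsDecomposition e n w

end Graphs

/-! ### Generalized connections and generalized gauge transformations -/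

section Generalized

variable {M P : Type*}

/-- The fibre of `π` over `x`. -/
abbrev BundleFiber (π : P → M) (x : M) : Type _ := {p : P // π p = x}

/-- Parallel transporters from the fibre over `x` to the fibre over `y`: the `G`-equivariant maps.
A choice of one point in each of the two fibres identifies them with elements of `G`. They carry
the topology of pointwise convergence, which corresponds to the topology of `G`. -/
abbrev FiberTransporter (G : Type*) [Group G] [MulAction Gᵐᵒᵖ P] (π : P → M) (x y : M) : Type _ :=
  {φ : BundleFiber π x → BundleFiber π y //
    ∀ (p p' : BundleFiber π x) (g : G), (p' : P) = (p : P) <• g →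
      (φ p' : P) = (φ p : P) <• g}

/-- The transporter `φ` takes the point `p` to the point `q`. -/
def FiberTransporter.Takes {G : Type*} [Group G] [MulAction Gᵐᵒᵖ P] {π : P → M} {x y : M}
    (φ : FiberTransporter G π x y) (p q : P) : Prop :=
  ∃ hp : π p = x, (φ.1 ⟨p, hp⟩ : P) = q

variable (E : Type*) [NormedAddCommGroup E] [NormedSpace ℝ E]
  [TopologicalSpace M] [ChartedSpace E M] (G : Type*) [Group G] [MulAction Gᵐᵒᵖ P]

/-- The space `𝒜_γ`: a parallel transporter for each edge of `γ`; the transporter of the inverse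
of an edge is the inverse. -/
abbrev GraphConnection (π : P → M) (γ : AnalyticGraph E M) : Type _ :=
  ∀ e : γ.edges, FiberTransporter G π e.1.source e.1.target

variable {E G} in
/-- Parallel transport along an edge run through forwards or backwards takes `p` to `q`. -/
def GraphConnection.Takes {π : P → M} {γ : AnalyticGraph E M} (a : GraphConnection E G π γ)
    (e : γ.edges) : Bool → P → P → Prop
  | true, p, q => FiberTransporter.Takes (a e) p q
  | false, p, q => FiberTransporter.Takes (a e) q p

variable {E G} in
/-- `a ∈ 𝒜_γ` is the image of `a' ∈ 𝒜_γ'` under the projection: along an edge of `γ`, parallel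
transport by `a` is the composition of the parallel transports by `a'` along the edges of `γ'` of
which that edge is composed. -/
def GraphConnection.IsProjection {π : P → M} {γ γ' : AnalyticGraph E M}
    (a' : GraphConnection E G π γ') (a : GraphConnection E G π γ) : Prop :=
  ∀ (e : γ.edges) (n : ℕ) (w : Fin n → γ'.edges × Bool), γ'.IsDecomposition e.1 n w →
    ∀ q : Fin (n + 1) → P,
      (∀ i : Fin n, GraphConnection.Takes a' (w i).1 (w i).2 (q i.castSucc) (q i.succ)) →
      FiberTransporter.Takes (a e) (q 0) (q (Fin.last n))

/-- The space of generalized connections on the bundle `π`: the projective limit of the spaces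
`𝒜_γ` over all piecewise analytic graphs, with its projective limit (Tychonov) topology. -/
abbrev GeneralizedConnection (π : P → M) : Type _ :=
  {A : ∀ γ : AnalyticGraph E M, GraphConnection E G π γ //
    ∀ γ γ' : AnalyticGraph E M, γ.Subgraph γ' →
      GraphConnection.IsProjection (A γ') (A γ)}

/-- The generalized gauge group of the bundle `π`: the projective limit, over all piecewise
analytic graphs `γ`, of the groups `𝒢_γ` of families of `G`-equivariant permutations of the fibres
over the vertices of `γ` (a choice of one point in a fibre identifies these permutations with
elements of `G`). -/
def generalizedGaugeGroup (π : P → M) :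
    Subgroup (∀ γ : AnalyticGraph E M, ∀ v : γ.verts, Equiv.Perm (BundleFiber π (v : M))) where
  carrier := {g |
    (∀ (γ : AnalyticGraph E M) (v : γ.verts) (p p' : BundleFiber π (v : M)) (h : G), (p' : P) = (p : P) <• h ↔
      (g γ v p' : P) = (g γ v p : P) <• h) ∧
    ∀ γ γ' : AnalyticGraph E M, γ.Subgraph γ' → ∀ (x : M) (hx : x ∈ γ.verts) (hx' : x ∈ γ'.verts),
      g γ ⟨x, hx⟩ = g γ' ⟨x, hx'⟩}
  one_mem' := ⟨fun _ _ _ _ _ => Iff.rfl, fun _ _ _ _ _ _ => rfl⟩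
  mul_mem' := by
    rintro g g' ⟨h1, h2⟩ ⟨h1', h2'⟩
    refine ⟨fun γ v p p' h => ?_, fun γ γ' hγ x hx hx' => ?_⟩
    · exact (h1' γ v p p' h).trans (h1 γ v _ _ h)
    · change g γ ⟨x, hx⟩ * g' γ ⟨x, hx⟩ = g γ' ⟨x, hx'⟩ * g' γ' ⟨x, hx'⟩
      rw [h2 γ γ' hγ x hx hx', h2' γ γ' hγ x hx hx']
  inv_mem' := by
    rintro g ⟨h1, h2⟩
    refine ⟨fun γ v p p' h => ?_, fun γ γ' hγ x hx hx' => ?_⟩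
    · have key := h1 γ v ((g γ v).symm p) ((g γ v).symm p') h
      rw [Equiv.apply_symm_apply, Equiv.apply_symm_apply] at key
      exact key.symm
    · change (g γ ⟨x, hx⟩)⁻¹ = (g γ' ⟨x, hx'⟩)⁻¹
      rw [h2 γ γ' hγ x hx hx']

variable {E G} in
/-- The gauge transformation `g` takes the generalized connection `A` to `A'`, that is,
`A'(e) = g(e(1)) ∘ A(e) ∘ g(e(0))⁻¹` for all edges `e` of all graphs. -/
def GeneralizedConnection.IsGaugeTransform {π : P → M} (g : generalizedGaugeGroup E G π)
    (A A' : GeneralizedConnection E G π) : Prop :=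
  ∀ (γ : AnalyticGraph E M) (e : γ.edges) (p : BundleFiber π e.1.source),
    (A'.1 γ e).1 (g.1 γ ⟨e.1.source, γ.source_mem e.1 e.2⟩ p) =
      g.1 γ ⟨e.1.target, γ.target_mem e.1 e.2⟩ ((A.1 γ e).1 p)

/-- Gauge equivalence of generalized connections. -/
instance gaugeSetoid (π : P → M) : Setoid (GeneralizedConnection E G π) where
  r A A' := ∃ g : generalizedGaugeGroup E G π, GeneralizedConnection.IsGaugeTransform g A A'
  iseqv := by
    refine ⟨fun A => ⟨1, fun γ e p => rfl⟩, ?_, ?_⟩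
    · rintro A A' ⟨g, hg⟩
      refine ⟨g⁻¹, fun γ e p => ?_⟩
      change (A.1 γ e).1 ((g.1 γ ⟨e.1.source, γ.source_mem e.1 e.2⟩).symm p) =
        (g.1 γ ⟨e.1.target, γ.target_mem e.1 e.2⟩).symm ((A'.1 γ e).1 p)
      have h := hg γ e ((g.1 γ ⟨e.1.source, γ.source_mem e.1 e.2⟩).symm p)
      rw [Equiv.apply_symm_apply] at h
      rw [h, Equiv.symm_apply_apply]
    · rintro A A' A'' ⟨g, hg⟩ ⟨g', hg'⟩
      refine ⟨g' * g, fun γ e p => ?_⟩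
      change (A''.1 γ e).1 (g'.1 γ ⟨e.1.source, γ.source_mem e.1 e.2⟩ (g.1 γ ⟨e.1.source, γ.source_mem e.1 e.2⟩ p)) =
        g'.1 γ ⟨e.1.target, γ.target_mem e.1 e.2⟩ (g.1 γ ⟨e.1.target, γ.target_mem e.1 e.2⟩ ((A.1 γ e).1 p))
      rw [hg' γ e, hg γ e]

/-- The space of generalized connections modulo generalized gauge transformations, with the
quotient topology. -/
abbrev GaugeInvariantConnection [TopologicalSpace P] (π : P → M) : Type _ :=
  Quotient (gaugeSetoid E G π)

variable {E G} in
/-- The generalized connection `A` is invariant under the action of `S` on the bundle: whenever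
the edge `e'` of `γ'` is the translate `s • e` of the edge `e` of `γ`, parallel transport along
`e'` is `s ∘ A(e) ∘ s⁻¹`. -/
def GeneralizedConnection.IsInvariant (S : Type*) [Group S] [MulAction S M] [MulAction S P]
    {π : P → M} (A : GeneralizedConnection E G π) : Prop :=
  ∀ (s : S) (γ γ' : AnalyticGraph E M) (e : γ.edges) (e' : γ'.edges),
    (∀ t, e'.1.curve t = s • e.1.curve t) →
    ∀ p q : P, FiberTransporter.Takes (A.1 γ e) p q →
      FiberTransporter.Takes (A.1 γ' e') (s • p) (s • q)

/-- The set of gauge-invariant generalized connections that are invariant under the action of `S`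
on the bundle: the gauge classes of `S`-invariant generalized connections. -/
def invariantConnections (S : Type*) [Group S] [MulAction S M] [MulAction S P]
    [TopologicalSpace P] (π : P → M) : Set (GaugeInvariantConnection E G π) :=
  {a | ∃ A : GeneralizedConnection E G π, A.IsInvariant S ∧ (⟦A⟧ : Quotient (gaugeSetoid E G π)) = a}

end Generalized

end

noncomputable section

namespace IsPrincipalBundle

variable {EG EM EP G M P : Type*}
  [NormedAddCommGroup EG] [NormedSpace ℝ EG] [NormedAddCommGroup EM] [NormedSpace ℝ EM]
  [NormedAddCommGroup EP] [NormedSpace ℝ EP]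
  [TopologicalSpace G] [Group G] [ChartedSpace EG G]
  [TopologicalSpace M] [ChartedSpace EM M] [TopologicalSpace P] [ChartedSpace EP P]
  [MulAction Gᵐᵒᵖ P] {π : P → M}

/-! Choose a point in every fibre, with no regularity in the base point. Transporters then become
elements of `G` (`holonomy`), and generalized gauge transformations become arbitrary functions `k :
M → G`, acting by `k(target) * h * k(source)⁻¹`. Each `s` contributes fixed elements of `G`, so
invariance of the transform of `A` by `k` is a family of equations in `G` between continuous
functions of `(A, k)`. As `G` is Hausdorff, they cut out a closed subset of `GeneralizedConnection ×
(M → G)`. The preimage of the invariant classes in the space of connections is the projection of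
this subset to the first factor. By Tychonoff `M → G` is compact, so that projection is a closed
map, and closedness descends to the quotient topology. The carrying lemmas are
`continuous_holonomy`, `exists_coord_gauge` and `isInvariant_iff`. -/

/-! ### Fibres as `G`-torsors and their coordinates. -/

theorem proj_smul (hπ : IsPrincipalBundle EG EM EP G π) (p : P) (g : G) :
    π (p <• g) = π p := by
  obtain ⟨U, -, hxU, Φ, -, -, -, h, -⟩ := hπ.locally_trivial (π p)
  exact (h p hxU g).1

theorem smul_injective (hπ : IsPrincipalBundle EG EM EP G π) (p : P) {g h : G}
    (hgh : p <• g = p <• h) : g = h := by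
  obtain ⟨U, -, hxU, Φ, -, -, -, H, -⟩ := hπ.locally_trivial (π p)
  have h1 := (H p hxU g).2
  rw [hgh, (H p hxU h).2] at h1
  exact (mul_left_cancel h1).symm

theorem exists_smul_eq (hπ : IsPrincipalBundle EG EM EP G π) {p q : P} (hpq : π p = π q) :
    ∃ g : G, p <• g = q := by
  obtain ⟨U, -, hxU, Φ, hs, -, h1, H, -⟩ := hπ.locally_trivial (π p)
  -- In a trivialization the action is right multiplication on the second component, which forces
  -- this witness.
  refine ⟨(Φ p).2⁻¹ * (Φ q).2, Φ.injOn ?_ ?_ ?_⟩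
  · rw [hs, Set.mem_preimage, hπ.proj_smul]; exact hxU
  · rw [hs, Set.mem_preimage, ← hpq]; exact hxU
  · refine Prod.ext ?_ ?_
    · rw [h1 _ (by rw [hπ.proj_smul]; exact hxU), h1 _ (hpq ▸ hxU), hπ.proj_smul, hpq]
    · rw [(H p hxU _).2, mul_inv_cancel_left]

theorem proj_surjective (hπ : IsPrincipalBundle EG EM EP G π) : Function.Surjective π := by
  intro x
  obtain ⟨U, -, hxU, Φ, hs, ht, h1, -⟩ := hπ.locally_trivial x
  have hx : (x, (1 : G)) ∈ Φ.target := by rw [ht]; exact ⟨hxU, trivial⟩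
  have hp := Φ.map_target hx
  rw [hs] at hp
  exact ⟨Φ.symm (x, 1), by rw [← h1 _ hp, Φ.right_inv hx]⟩

/-- A chosen point of the fibre over `x`. -/
def basePoint (hπ : IsPrincipalBundle EG EM EP G π) (x : M) : P := (hπ.proj_surjective x).choose

theorem proj_basePoint (hπ : IsPrincipalBundle EG EM EP G π) (x : M) :
    π (hπ.basePoint x) = x := (hπ.proj_surjective x).choose_spec

/-- The element of `G` that takes the chosen point of the fibre of `p` to `p`. -/
def coord (hπ : IsPrincipalBundle EG EM EP G π) (p : P) : G :=
  (hπ.exists_smul_eq (hπ.proj_basePoint (π p))).choose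

theorem basePoint_smul_coord (hπ : IsPrincipalBundle EG EM EP G π) (p : P) :
    hπ.basePoint (π p) <• hπ.coord p = p :=
  (hπ.exists_smul_eq (hπ.proj_basePoint (π p))).choose_spec

theorem coord_smul (hπ : IsPrincipalBundle EG EM EP G π) (p : P) (g : G) :
    hπ.coord (p <• g) = hπ.coord p * g := by
  apply hπ.smul_injective (hπ.basePoint (π p))
  have h := hπ.basePoint_smul_coord (p <• g)
  rw [hπ.proj_smul] at h
  rw [h, MulOpposite.op_mul, mul_smul, hπ.basePoint_smul_coord]

@[simp] theorem coord_basePoint (hπ : IsPrincipalBundle EG EM EP G π) (x : M) :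
    hπ.coord (hπ.basePoint x) = 1 := by
  apply hπ.smul_injective (hπ.basePoint x)
  have h := hπ.basePoint_smul_coord (hπ.basePoint x)
  rw [hπ.proj_basePoint] at h
  rw [h, MulOpposite.op_one, one_smul]

theorem ext_coord (hπ : IsPrincipalBundle EG EM EP G π) {p q : P} (h : π p = π q)
    (h' : hπ.coord p = hπ.coord q) : p = q := by
  rw [← hπ.basePoint_smul_coord p, ← hπ.basePoint_smul_coord q, h, h']

/-- On one fibre, `coord` differs from the `G`-component of a local trivialization by a fixed left
translation. Since base points are chosen arbitrarily, continuity is claimed only fibrewise. -/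
theorem continuousOn_coord [ContinuousMul G] (hπ : IsPrincipalBundle EG EM EP G π) (x : M) :
    ContinuousOn hπ.coord {p | π p = x} := by
  obtain ⟨U, -, hxU, Φ, hs, -, -, H, -⟩ := hπ.locally_trivial x
  have hsub : {p | π p = x} ⊆ Φ.source := by
    rintro p rfl
    rw [hs]; exact hxU
  have hc : ContinuousOn (fun p => (Φ (hπ.basePoint x)).2⁻¹ * (Φ p).2) {p | π p = x} :=
    continuousOn_const.mul (continuous_snd.comp_continuousOn (Φ.continuousOn.mono hsub))
  refine hc.congr ?_
  rintro p rfl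
  have h := (H (hπ.basePoint (π p)) (by rwa [hπ.proj_basePoint]) (hπ.coord p)).2
  rw [hπ.basePoint_smul_coord] at h
  simp only [h, inv_mul_cancel_left]

/-! ### Gauge transformations from functions `M → G`. -/

/-- The bundle automorphism over the identity that multiplies coordinates over `x` by `k x` from
the left. -/
def gaugeMap (hπ : IsPrincipalBundle EG EM EP G π) (k : M → G) (p : P) : P :=
  hπ.basePoint (π p) <• (k (π p) * hπ.coord p)

theorem proj_gaugeMap (hπ : IsPrincipalBundle EG EM EP G π) (k : M → G) (p : P) :
    π (hπ.gaugeMap k p) = π p := by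
  rw [gaugeMap, hπ.proj_smul, hπ.proj_basePoint]

@[simp] theorem coord_gaugeMap (hπ : IsPrincipalBundle EG EM EP G π) (k : M → G) (p : P) :
    hπ.coord (hπ.gaugeMap k p) = k (π p) * hπ.coord p := by
  rw [gaugeMap, hπ.coord_smul, coord_basePoint, one_mul]

theorem gaugeMap_smul (hπ : IsPrincipalBundle EG EM EP G π) (k : M → G) (p : P) (g : G) :
    hπ.gaugeMap k (p <• g) = hπ.gaugeMap k p <• g :=
  hπ.ext_coord (by simp only [hπ.proj_gaugeMap, hπ.proj_smul])
    (by simp only [coord_gaugeMap, hπ.proj_smul, hπ.coord_smul, mul_assoc])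

/-- `gaugeMap` as an equivalence of the total space. -/
def gaugeEquiv (hπ : IsPrincipalBundle EG EM EP G π) (k : M → G) : P ≃ P where
  toFun := hπ.gaugeMap k
  invFun := hπ.gaugeMap k⁻¹
  left_inv p := hπ.ext_coord (by simp [hπ.proj_gaugeMap]) (by simp [hπ.proj_gaugeMap])
  right_inv p := hπ.ext_coord (by simp [hπ.proj_gaugeMap]) (by simp [hπ.proj_gaugeMap])

theorem proj_gaugeEquiv (hπ : IsPrincipalBundle EG EM EP G π) (k : M → G) (p : P) :
    π (hπ.gaugeEquiv k p) = π p := hπ.proj_gaugeMap k p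

theorem proj_gaugeEquiv_symm (hπ : IsPrincipalBundle EG EM EP G π) (k : M → G) (p : P) :
    π ((hπ.gaugeEquiv k).symm p) = π p := hπ.proj_gaugeMap k⁻¹ p

theorem coord_gaugeEquiv (hπ : IsPrincipalBundle EG EM EP G π) (k : M → G) (p : P) :
    hπ.coord (hπ.gaugeEquiv k p) = k (π p) * hπ.coord p := hπ.coord_gaugeMap k p

theorem gaugeEquiv_smul (hπ : IsPrincipalBundle EG EM EP G π) (k : M → G) (p : P) (g : G) :
    hπ.gaugeEquiv k (p <• g) = hπ.gaugeEquiv k p <• g := hπ.gaugeMap_smul k p g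

theorem gaugeEquiv_symm_smul (hπ : IsPrincipalBundle EG EM EP G π) (k : M → G) (p : P) (g : G) :
    (hπ.gaugeEquiv k).symm (p <• g) = (hπ.gaugeEquiv k).symm p <• g := hπ.gaugeMap_smul k⁻¹ p g

/-- The permutation of a fibre induced by `gaugeEquiv`. -/
def fiberPerm (hπ : IsPrincipalBundle EG EM EP G π) (k : M → G) (x : M) :
    Equiv.Perm (BundleFiber π x) :=
  (hπ.gaugeEquiv k).subtypeEquiv fun p => by rw [hπ.proj_gaugeEquiv]

@[simp] theorem coe_fiberPerm (hπ : IsPrincipalBundle EG EM EP G π) (k : M → G) (x : M)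
    (p : BundleFiber π x) : (hπ.fiberPerm k x p : P) = hπ.gaugeEquiv k p := rfl

@[simp] theorem coe_fiberPerm_symm (hπ : IsPrincipalBundle EG EM EP G π) (k : M → G) (x : M)
    (p : BundleFiber π x) : ((hπ.fiberPerm k x).symm p : P) = (hπ.gaugeEquiv k).symm p := rfl

/-- The generalized gauge transformation with coordinates `k`. -/
def gaugeElement (hπ : IsPrincipalBundle EG EM EP G π) (k : M → G) :
    generalizedGaugeGroup EM G π :=
  ⟨fun _ v => hπ.fiberPerm k v, by
    refine ⟨fun γ v p p' h => ?_, fun _ _ _ _ _ _ => rfl⟩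
    rw [coe_fiberPerm, coe_fiberPerm, ← hπ.gaugeEquiv_smul, EmbeddingLike.apply_eq_iff_eq]⟩

/-- Conjugation of a transporter by a gauge transformation. -/
def conjTransporter (hπ : IsPrincipalBundle EG EM EP G π) (k : M → G) {x y : M}
    (φ : FiberTransporter G π x y) : FiberTransporter G π x y :=
  ⟨fun p => hπ.fiberPerm k y (φ.1 ((hπ.fiberPerm k x).symm p)), fun p p' g h => by
    rw [coe_fiberPerm, coe_fiberPerm, ← hπ.gaugeEquiv_smul]
    congr 1
    refine φ.2 _ _ g ?_
    rw [coe_fiberPerm_symm, coe_fiberPerm_symm, h, hπ.gaugeEquiv_symm_smul]⟩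

theorem takes_conjTransporter (hπ : IsPrincipalBundle EG EM EP G π) (k : M → G) {x y : M}
    (φ : FiberTransporter G π x y) (p q : P) :
    FiberTransporter.Takes (hπ.conjTransporter k φ) p q ↔
      FiberTransporter.Takes φ ((hπ.gaugeEquiv k).symm p) ((hπ.gaugeEquiv k).symm q) := by
  constructor
  · rintro ⟨hp, rfl⟩
    exact ⟨by rwa [hπ.proj_gaugeEquiv_symm], ((hπ.gaugeEquiv k).symm_apply_apply _).symm⟩
  · rintro ⟨hp, h⟩
    exact ⟨by rwa [hπ.proj_gaugeEquiv_symm] at hp, (Equiv.eq_symm_apply _).1 h⟩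

/-- The action of a gauge transformation on generalized connections. -/
def gaugeAct (hπ : IsPrincipalBundle EG EM EP G π) (k : M → G)
    (A : GeneralizedConnection EM G π) : GeneralizedConnection EM G π :=
  ⟨fun γ e => hπ.conjTransporter k (A.1 γ e), fun γ γ' hγ e n w hw q hq => by
    rw [takes_conjTransporter]
    -- A chain of points transported by the conjugated connection, pulled back by the gauge map, is
    -- a chain transported by `A`.
    refine A.2 γ γ' hγ e n w hw (fun i => (hπ.gaugeEquiv k).symm (q i)) fun i => ?_
    have h := hq i
    revert h
    cases (w i).2
    · exact (hπ.takes_conjTransporter k _ _ _).1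
    · exact (hπ.takes_conjTransporter k _ _ _).1⟩

theorem isGaugeTransform_gaugeAct (hπ : IsPrincipalBundle EG EM EP G π) (k : M → G)
    (A : GeneralizedConnection EM G π) :
    GeneralizedConnection.IsGaugeTransform (hπ.gaugeElement k) A (hπ.gaugeAct k A) := by
  intro γ e p
  change hπ.fiberPerm k _ ((A.1 γ e).1 ((hπ.fiberPerm k _).symm (hπ.fiberPerm k _ p))) = _
  rw [Equiv.symm_apply_apply]
  rfl

/-! ### Holonomies and the gauge group in coordinates. -/

/-- The coordinate in `G` of the parallel transport along an edge. -/
def holonomy (hπ : IsPrincipalBundle EG EM EP G π) (A : GeneralizedConnection EM G π)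
    (γ : AnalyticGraph EM M) (e : γ.edges) : G :=
  hπ.coord ((A.1 γ e).1 ⟨hπ.basePoint e.1.source, hπ.proj_basePoint _⟩)

/-- A right-equivariant map of torsors is a left multiplication, fixed by its value at the base
point. -/
theorem coord_transport (hπ : IsPrincipalBundle EG EM EP G π) (A : GeneralizedConnection EM G π)
    (γ : AnalyticGraph EM M) (e : γ.edges) (p : BundleFiber π e.1.source) :
    hπ.coord ((A.1 γ e).1 p) = hπ.holonomy A γ e * hπ.coord p := by
  have h := (A.1 γ e).2 ⟨hπ.basePoint e.1.source, hπ.proj_basePoint _⟩ p (hπ.coord p) (by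
    have h := hπ.basePoint_smul_coord (p : P)
    rw [p.2] at h
    exact h.symm)
  rw [h, hπ.coord_smul]
  rfl

/-- Evaluation at one point is continuous for pointwise convergence, and its values stay in a single
fibre, where `coord` is continuous. -/
theorem continuous_holonomy [ContinuousMul G] (hπ : IsPrincipalBundle EG EM EP G π)
    (γ : AnalyticGraph EM M) (e : γ.edges) :
    Continuous fun A : GeneralizedConnection EM G π => hπ.holonomy A γ e := by
  refine (hπ.continuousOn_coord e.1.target).comp_continuous ?_ fun A => Subtype.property _
  exact continuous_subtype_val.comp <| (continuous_apply _).comp <| continuous_subtype_val.comp <|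
    (continuous_apply e).comp <| (continuous_apply γ).comp continuous_subtype_val

/-- A generalized gauge transformation acts on the coordinates of transporters by the elements
of `G` through which it acts over the vertices. -/
theorem holonomy_gaugeTransform (hπ : IsPrincipalBundle EG EM EP G π)
    {g : generalizedGaugeGroup EM G π} {k : M → G}
    (hk : ∀ (γ : AnalyticGraph EM M) (v : γ.verts) (p : BundleFiber π (v : M)),
      hπ.coord (g.1 γ v p) = k v * hπ.coord p)
    {A A' : GeneralizedConnection EM G π} (h : GeneralizedConnection.IsGaugeTransform g A A')
    (γ : AnalyticGraph EM M) (e : γ.edges) :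
    hπ.holonomy A' γ e = k e.1.target * hπ.holonomy A γ e * (k e.1.source)⁻¹ := by
  have h1 := congrArg (fun p : BundleFiber π e.1.target => hπ.coord (p : P))
    (h γ e ⟨hπ.basePoint e.1.source, hπ.proj_basePoint _⟩)
  simp only [coord_transport, hk, coord_basePoint, mul_one] at h1
  rw [← h1, mul_inv_cancel_right]

theorem holonomy_gaugeAct (hπ : IsPrincipalBundle EG EM EP G π) (k : M → G)
    (A : GeneralizedConnection EM G π) (γ : AnalyticGraph EM M) (e : γ.edges) :
    hπ.holonomy (hπ.gaugeAct k A) γ e =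
      k e.1.target * hπ.holonomy A γ e * (k e.1.source)⁻¹ := by
  refine hπ.holonomy_gaugeTransform (g := hπ.gaugeElement k) (fun γ v p => ?_)
    (hπ.isGaugeTransform_gaugeAct k A) γ e
  have h := hπ.coord_gaugeEquiv k (p : P)
  rw [p.2] at h
  exact h

/-- Every generalized gauge transformation is given by one element of `G` for each point of the
base. -/
theorem exists_coord_gauge (hπ : IsPrincipalBundle EG EM EP G π)
    (g : generalizedGaugeGroup EM G π) :
    ∃ k : M → G, ∀ (γ : AnalyticGraph EM M) (v : γ.verts) (p : BundleFiber π (v : M)),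
      hπ.coord (g.1 γ v p) = k v * hπ.coord p := by
  -- The edgeless graph with vertex `x` lies below every graph having `x` as a vertex, so
  -- compatibility makes the action over `x` independent of the graph.
  let pt : M → AnalyticGraph EM M := fun x =>
    { verts := {x}
      edges := ∅
      finite_verts := Set.finite_singleton x
      finite_edges := Set.finite_empty
      source_mem := fun e he => he.elim
      target_mem := fun e he => he.elim
      interior_verts := fun e he => he.elim
      interior_edges := fun e he => he.elim }
  refine ⟨fun x => hπ.coord (g.1 (pt x) ⟨x, rfl⟩ ⟨hπ.basePoint x, hπ.proj_basePoint x⟩), ?_⟩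
  rintro γ ⟨x, hx⟩ p
  have h : g.1 (pt x) ⟨x, rfl⟩ = g.1 γ ⟨x, hx⟩ :=
    g.2.2 (pt x) γ ⟨Set.singleton_subset_iff.2 hx, fun e he => he.elim⟩ x rfl hx
  have h' := (g.2.1 γ ⟨x, hx⟩ ⟨hπ.basePoint x, hπ.proj_basePoint x⟩ p (hπ.coord p)).1 (by
    have h := hπ.basePoint_smul_coord (p : P)
    rw [p.2] at h
    exact h.symm)
  dsimp only at h h' ⊢
  rw [h', hπ.coord_smul, h]

/-! ### Invariance in coordinates and closedness. -/

variable {ES S : Type*} [NormedAddCommGroup ES] [NormedSpace ℝ ES] [TopologicalSpace S] [Group S]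
  [ChartedSpace ES S] [MulAction S P] [MulAction S M]

/-- Invariance of a generalized connection in coordinates. -/
theorem isInvariant_iff (hπ : IsPrincipalBundle EG EM EP G π)
    (hS : IsSymmetryAction ES EP S G π) (A : GeneralizedConnection EM G π) :
    A.IsInvariant S ↔ ∀ (s : S) (γ γ' : AnalyticGraph EM M) (e : γ.edges) (e' : γ'.edges),
      (∀ t, e'.1.curve t = s • e.1.curve t) →
      hπ.holonomy A γ' e' * hπ.coord (s • hπ.basePoint e.1.source) =
        hπ.coord (s • hπ.basePoint e.1.target) * hπ.holonomy A γ e := by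
  -- As `s` commutes with `G`, it too acts between fibres by left multiplication, so invariance need
  -- only be tested at the base point.
  have coord_symm (s : S) (p : P) :
      hπ.coord (s • p) = hπ.coord (s • hπ.basePoint (π p)) * hπ.coord p := by
    rw [← hπ.coord_smul, ← hS.commutes, hπ.basePoint_smul_coord]
  refine forall₅_congr fun s γ γ' e e' => forall_congr' fun he => ?_
  have hsrc : e'.1.source = s • e.1.source := he 0
  have htgt : e'.1.target = s • e.1.target := he 1
  have key (p : BundleFiber π e.1.source) : hπ.coord (s • ((A.1 γ e).1 p : P)) =
      hπ.coord (s • hπ.basePoint e.1.target) * hπ.holonomy A γ e * hπ.coord (p : P) := by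
    rw [coord_symm, ((A.1 γ e).1 p).2, coord_transport, mul_assoc]
  constructor
  · intro h
    obtain ⟨h1, h2⟩ := h _ _ ⟨hπ.proj_basePoint e.1.source, rfl⟩
    have h3 := congrArg hπ.coord h2
    rwa [coord_transport, key, coord_basePoint, mul_one] at h3
  · rintro h p _ ⟨hp, rfl⟩
    have hsp : π (s • p) = e'.1.source := by rw [hS.covers, hp, hsrc]
    refine ⟨hsp, hπ.ext_coord ?_ ?_⟩
    · rw [((A.1 γ' e').1 _).2, hS.covers, ((A.1 γ e).1 _).2, htgt]
    · rw [coord_transport, key, ← h, coord_symm s p, hp, mul_assoc]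

/-- Exhibits the invariant classes as a projection along the space `M → G`. -/
theorem mk_mem_invariantConnections_iff (hπ : IsPrincipalBundle EG EM EP G π)
    (hS : IsSymmetryAction ES EP S G π) (A : GeneralizedConnection EM G π) :
    (⟦A⟧ : GaugeInvariantConnection EM G π) ∈ invariantConnections EM G S π ↔
      ∃ k : M → G, (hπ.gaugeAct k A).IsInvariant S := by
  constructor
  · rintro ⟨A', hA', h⟩
    obtain ⟨g, hg⟩ := Quotient.exact h.symm
    obtain ⟨k, hk⟩ := hπ.exists_coord_gauge g
    refine ⟨k, ?_⟩
    rw [hπ.isInvariant_iff hS] at hA' ⊢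
    -- `A'` and `gaugeAct k A` have the same holonomies, and invariance depends only on these.
    simpa only [holonomy_gaugeAct, hπ.holonomy_gaugeTransform hk hg] using hA'
  · rintro ⟨k, hk⟩
    exact ⟨_, hk, (Quotient.sound ⟨_, hπ.isGaugeTransform_gaugeAct k A⟩ :
      (⟦A⟧ : GaugeInvariantConnection EM G π) = _).symm⟩

theorem isClosed_invariantConnections [IsTopologicalGroup G] [CompactSpace G] [T2Space G]
    (hπ : IsPrincipalBundle EG EM EP G π) (hS : IsSymmetryAction ES EP S G π) :
    IsClosed (invariantConnections EM G S π) := by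
  have hcl : IsClosed {z : GeneralizedConnection EM G π × (M → G) |
      (hπ.gaugeAct z.2 z.1).IsInvariant S} := by
    simp only [hπ.isInvariant_iff hS, holonomy_gaugeAct, Set.ofPred_forall]
    refine isClosed_iInter fun s => isClosed_iInter fun γ => isClosed_iInter fun γ' =>
      isClosed_iInter fun e => isClosed_iInter fun e' => isClosed_iInter fun _ => ?_
    have h1 := (hπ.continuous_holonomy γ e).comp
      (continuous_fst (X := GeneralizedConnection EM G π) (Y := M → G))
    have h2 := (hπ.continuous_holonomy γ' e').comp
      (continuous_fst (X := GeneralizedConnection EM G π) (Y := M → G))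
    have hk (x : M) : Continuous fun z : GeneralizedConnection EM G π × (M → G) => z.2 x :=
      (continuous_apply x).comp continuous_snd
    -- The coordinates of `s • basePoint` do not depend on `(A, k)`.
    exact isClosed_eq ((((hk _).mul h2).mul (hk _).inv).mul continuous_const)
      (continuous_const.mul (((hk _).mul h1).mul (hk _).inv))
  rw [← isQuotientMap_quotient_mk'.isClosed_preimage]
  -- Compactness of `G` enters here, through that of `M → G`.
  convert isClosedMap_fst_of_compactSpace _ hcl using 1
  ext A
  rw [Set.mem_preimage]
  refine (hπ.mk_mem_invariantConnections_iff hS A).trans ?_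
  simp

end IsPrincipalBundle

end

theorem mainTheorem4
    {EG EM EP ES G M P S : Type*}
    [NormedAddCommGroup EG] [NormedSpace ℝ EG] [FiniteDimensional ℝ EG]
    [NormedAddCommGroup EM] [NormedSpace ℝ EM] [FiniteDimensional ℝ EM]
    [NormedAddCommGroup EP] [NormedSpace ℝ EP] [FiniteDimensional ℝ EP]
    [NormedAddCommGroup ES] [NormedSpace ℝ ES] [FiniteDimensional ℝ ES]
    -- the compact structure group
    [TopologicalSpace G] [Group G] [ChartedSpace EG G] [LieGroup 𝓘(ℝ, EG) ω G]
    [CompactSpace G] [T2Space G]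
    -- the symmetry group
    [TopologicalSpace S] [Group S] [ChartedSpace ES S] [LieGroup 𝓘(ℝ, ES) ω S]
    -- the base manifold
    [TopologicalSpace M] [ChartedSpace EM M] [IsManifold 𝓘(ℝ, EM) ω M] [T2Space M]
    -- the total space
    [TopologicalSpace P] [ChartedSpace EP P] [IsManifold 𝓘(ℝ, EP) ω P]
    [MulAction Gᵐᵒᵖ P] [MulAction S P] [MulAction S M]
    (π : P → M) (hπ : IsPrincipalBundle EG EM EP G π)
    (hS : IsSymmetryAction ES EP S G π)
    (F : Subgroup S) (B : Set M) (lam : F →* G) (hlam : IsClassifiedBy π F B lam) :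
    IsClosed (invariantConnections EM G S π) := by
  have := topologicalGroup_of_lieGroup 𝓘(ℝ, EG) ω (G := G)
  exact hπ.isClosed_invariantConnections hS
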